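/- For a totally real number field $F$ of degree $n$ with ring of integers $\mathbb{Z}_F$ and real embeddings $\sigma_1,\dots,\sigma_n$, let $B=\left(\frac{-1,-1}{F}\right)$ be the quaternion algebra with $F$-basis $1,i,j,k$, $i^2=j^2=-1$, $ij=-ji=k$. An order of $B$ is a subring that is a finitely generated $\mathbb{Z}_F$-module spanning $B$ over $F$; it is maximal if it is not properly contained in another order. For an order $\mathcal{O}$ of $B$ and a totally positive $\alpha\in F$ let $\Lambda_{(\mathcal{O},\alpha)}\subset\mathbb{R}^{4n}$ be the image of $\mathcal{O}$ under $$x+yi+zj+tk\mapsto\bigl(\sqrt{2\sigma_l(\alpha)}\,\sigma_l(u)\bigr)_{u\in\{x,y,z,t\},\ 1\le l\le n}.$$ Two lattices are similar, written $\sim$, if a linear isometry followed by scaling with a positive real number maps one onto the other. Then the set $$\mathcal{T}_{E_8}=\left\{F\text{ totally real quadratic}\ \middle|\ \Lambda_{(\mathcal{O},\alpha)}\sim E_8\text{ for some maximal order }\mathcal{O}\subseteq\left(\tfrac{-1,-1}{F}\right)\text{ and some totally positive }\alpha\in F\right\}$$ (fields taken up to isomorphism, equivalently as subfields of $\mathbb{R}$)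 is infinite. Explicitly, the set of fields $\mathbb{Q}(\sqrt{D})$, where $D=s^2+4$ is square-free with $s\in\mathbb{Z}$, is infinite and contained in $\mathcal{T}_{E_8}$. More precisely, for every such $s$ and $D$, and $F=\mathbb{Q}(\sqrt D)$ (with either choice of the square root), $F$ is a totally real quadratic field, the element $\alpha=\varepsilon/\sqrt{D}$ with $\varepsilon=\frac{s+\sqrt{D}}{2}$ is totally positive, the $\mathbb{Z}_F$-module $\mathcal{O}$ generated by $$1,\quad i,\quad \tfrac{\sqrt{D}+1}{4}+\tfrac{\sqrt{D}+3}{4}\,i+\tfrac{j}{2},\quad \tfrac{\sqrt{D}+3}{4}+\tfrac{\sqrt{D}+1}{4}\,i+\tfrac{k}{2}$$ is a maximal order of $\left(\frac{-1,-1}{F}\right)$, and $\Lambda_{(\mathcal{O},\alpha)}\sim E_8$. -/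

import Mathlib

open scoped Quaternion NumberField IntermediateField

/-- The `E₈` lattice in `ℝ⁸`: the vectors whose coordinates are all integers or all
half-integers (elements of `ℤ + 1/2`), and whose coordinate sum is an even integer. -/
def latticeE8 : AddSubgroup (EuclideanSpace ℝ (Fin 8)) where
  carrier := {v | ((∀ l, ∃ m : ℤ, v l = m) ∨ (∀ l, ∃ m : ℤ, v l = m + 1 / 2)) ∧
    ∃ m : ℤ, ∑ l, v l = 2 * m}
  zero_mem' := ⟨Or.inl fun _ => ⟨0, by simp⟩, 0, by simp⟩
  add_mem' := by
    rintro v w ⟨hv, m, hm⟩ ⟨hw, k, hk⟩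
    refine ⟨?_, m + k, by simp [Finset.sum_add_distrib, hm, hk]; ring⟩
    rcases hv with hv | hv <;> rcases hw with hw | hw
    · left; intro l; obtain ⟨a, ha⟩ := hv l; obtain ⟨b, hb⟩ := hw l
      exact ⟨a + b, by simp [ha, hb]⟩
    · right; intro l; obtain ⟨a, ha⟩ := hv l; obtain ⟨b, hb⟩ := hw l
      exact ⟨a + b, by simp [ha, hb]; ring⟩
    · right; intro l; obtain ⟨a, ha⟩ := hv l; obtain ⟨b, hb⟩ := hw l
      exact ⟨a + b, by simp [ha, hb]; ring⟩
    · left; intro l; obtain ⟨a, ha⟩ := hv l; obtain ⟨b, hb⟩ := hw l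
      exact ⟨a + b + 1, by simp [ha, hb]; ring⟩
  neg_mem' := by
    rintro v ⟨hv, m, hm⟩
    refine ⟨?_, -m, by simp [hm]⟩
    rcases hv with hv | hv
    · left; intro l; obtain ⟨a, ha⟩ := hv l
      exact ⟨-a, by simp [ha]⟩
    · right; intro l; obtain ⟨a, ha⟩ := hv l
      exact ⟨-a - 1, by simp [ha]; ring⟩

/-- Two lattices in Euclidean spaces are similar if a linear isometry between the spaces,
followed by scaling with a positive real number, maps one onto the other. -/
def LatticeSimilar {V W : Type*} [NormedAddCommGroup V] [InnerProductSpace ℝ V]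
    [NormedAddCommGroup W] [InnerProductSpace ℝ W]
    (L : AddSubgroup V) (M : AddSubgroup W) : Prop :=
  ∃ (c : ℝ) (φ : V ≃ₗᵢ[ℝ] W), 0 < c ∧ (fun v => c • φ v) '' (L : Set V) = (M : Set W)

section Orders

variable {F : Type*} [Field F]

/-- An order of the quaternion algebra `ℍ[F] = (-1, -1 / F)`: a subring which is a
`𝓞 F`-lattice of full rank, i.e. a finitely generated `𝓞 F`-module spanning `ℍ[F]` over `F`. -/
def IsQuaternionOrder (O : Subalgebra (𝓞 F) ℍ[F]) : Prop :=
  (Subalgebra.toSubmodule O).FG ∧ Submodule.span F (O : Set ℍ[F]) = ⊤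

/-- An order which is not properly contained in another order. -/
def IsMaximalQuaternionOrder (O : Subalgebra (𝓞 F) ℍ[F]) : Prop :=
  IsQuaternionOrder O ∧
    ∀ O' : Subalgebra (𝓞 F) ℍ[F], IsQuaternionOrder O' → O ≤ O' → O' = O

/-- All real embeddings of `α` are positive (used for totally real `F`). -/
def IsTotallyPositive (α : F) : Prop := ∀ σ : F →+* ℝ, 0 < σ α

/-- The four coordinates of a quaternion with respect to the basis `1, i, j, k`. -/
def quaternionCoord (q : ℍ[F]) : Fin 4 → F := ![q.re, q.imI, q.imJ, q.imK]

/-- The `𝓞 F`-module generated by `1`, `i`, `(δ + 1)/4 + (δ + 3)/4 i + j/2` and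
`(δ + 3)/4 + (δ + 1)/4 i + k/2`, where `δ` stands for a square root `√D` in `F = ℚ(√D)`. -/
def explicitOrderModule (δ : F) : Submodule (𝓞 F) ℍ[F] :=
  Submodule.span (𝓞 F)
    {⟨1, 0, 0, 0⟩, ⟨0, 1, 0, 0⟩,
      ⟨(δ + 1) / 4, (δ + 3) / 4, 1 / 2, 0⟩, ⟨(δ + 3) / 4, (δ + 1) / 4, 0, 1 / 2⟩}

variable [NumberField F]

/-- The embedding of `ℍ[F]` twisted by `α`: the quaternion `x + y i + z j + t k` is sent to the
vector with the coordinates `√(2 σ(α)) σ(u)`, for `u ∈ {x, y, z, t}` and `σ` a real embedding. -/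
noncomputable def twistedEmbedding (α : F) :
    ℍ[F] →+ EuclideanSpace ℝ (Fin 4 × (F →+* ℝ)) where
  toFun q := WithLp.toLp 2 fun p => √(2 * p.2 α) * p.2 (quaternionCoord q p.1)
  map_zero' := by
    ext ⟨l, σ⟩
    fin_cases l <;> simp [quaternionCoord]
  map_add' q r := by
    ext ⟨l, σ⟩
    fin_cases l <;> simp [quaternionCoord, mul_add]

/-- The lattice given by `O` and twisted by `α`. -/
noncomputable def twistedLattice (O : Subalgebra (𝓞 F) ℍ[F]) (α : F) :
    AddSubgroup (EuclideanSpace ℝ (Fin 4 × (F →+* ℝ))) :=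
  (Subalgebra.toSubmodule O).toAddSubgroup.map (twistedEmbedding α)

end Orders

/-- The totally real quadratic fields `F` for which some maximal order `O` of `(-1, -1 / F)` and
some totally positive `α ∈ F` give a lattice similar to `E₈`. Every real quadratic field is
isomorphic to exactly one subfield of `ℝ`, so the fields are taken inside `ℝ`. -/
def quadraticFieldsE8 : Set (IntermediateField ℚ ℝ) :=
  {F | ∃ _ : NumberField F, Module.finrank ℚ F = 2 ∧ NumberField.IsTotallyReal F ∧
    ∃ (O : Subalgebra (𝓞 F) ℍ[F]) (α : F), IsMaximalQuaternionOrder O ∧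
      IsTotallyPositive α ∧ LatticeSimilar (twistedLattice O α) latticeE8}

/-!
Put `D = s² + 4`, `δ = √D`, `w = (1 + δ) / 2`, `η = (δ - s) / 2` and `α = (s + δ) / (2δ)`.

Since `D` is square-free, `s` is odd and `D ≡ 5 mod 8`, so that the ring of integers of `F` is
`ℤ[w] = ℤ ⊕ ℤη`. The module `explicitOrderModule δ` is closed under multiplication because
`w² = w + 2u + 1` with an integer `u`. It is its own dual for the reduced trace, and the reduced
trace takes integral values on any order, so an order containing it is equal to it
(`isMaximalQuaternionOrder_of_toSubmodule_eq`).

The element `α` satisfies `Tr α = 1`, `Tr (α η) = 0` and `Tr (α η²) = 1`. Hence `1, η` is an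
orthonormal basis of `F` for the form `Tr (α x y)`, and in the coordinates given by this basis the
twisted lattice is `1 / √2` times the lattice of all vectors of `ℤ⁸` that reduce modulo two to a
codeword of the order modulo two, an extended Hamming code. The
orthogonal map `(x, y) ↦ (x + y, x - y) / √2` on each of four suitable pairs of coordinates sends
this lattice onto `E₈`
(`mem_latticeE8_iff`, `IsSquarefreeGenerator.latticeSimilar`). The code depends on `s mod 4` only
through an exchange of two coordinates of the quaternions
(`IsSquarefreeGenerator.exists_perm_mem_iff`).

There are infinitely many such fields because `s² + 4` is square-free for a positive proportion of
the odd `s` (`infinite_squarefree_sq_add_four`): a prime whose square divides `s² + 4` is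
`1 mod 4`, which makes the trivial bound for the number of large primes sufficient. Different
square-free values give different fields (`adjoin_sqrt_injOn`).
-/

/-! ### Square-free values of `s² + 4` -/

theorem prime_mod_four_of_dvd {p a : ℕ} (hp : p.Prime) (h : p ∣ (2 * a + 1) ^ 2 + 4) :
    p % 4 = 1 := by
  have hp2 : p ≠ 2 := by
    rintro rfl
    rw [show (2 * a + 1) ^ 2 + 4 = 2 * (2 * a ^ 2 + 2 * a + 2) + 1 by ring] at h
    omega
  have : Fact p.Prime := ⟨hp⟩
  have h2 : (2 : ZMod p) ≠ 0 := by
    have := (ZMod.natCast_eq_zero_iff 2 p).not.mpr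
      (fun h => hp2 ((Nat.prime_dvd_prime_iff_eq hp Nat.prime_two).mp h))
    simpa using this
  have h0 : ((2 * a + 1 : ZMod p)) ^ 2 + 4 = 0 := by
    have := (ZMod.natCast_eq_zero_iff _ _).mpr h
    push_cast at this
    exact this
  have hsq : ((2 * a + 1 : ZMod p) / 2) ^ 2 = -1 := by
    field_simp
    linear_combination h0
  have h3 := ZMod.mod_four_ne_three_of_sq_eq_neg_one hsq
  have := hp.eq_two_or_odd
  omega

/-- For a prime `p`, the congruence `x² ≡ -4 mod p²` has at most the two odd solutions
`± (2l + 1)`. -/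
theorem modEq_of_sq_dvd {p k l : ℕ} (hp : p.Prime) (hk : p ^ 2 ∣ (2 * k + 1) ^ 2 + 4)
    (hl : p ^ 2 ∣ (2 * l + 1) ^ 2 + 4) :
    ((p : ℤ) ^ 2 ∣ (k : ℤ) - l) ∨ ((p : ℤ) ^ 2 ∣ (k : ℤ) + l + 1) := by
  have h4 := prime_mod_four_of_dvd hp ((dvd_pow_self p two_ne_zero).trans hk)
  have hpZ : Prime (p : ℤ) := Nat.prime_iff_prime_int.mp hp
  have hp2 : ¬ (p : ℤ) ∣ 2 := by
    intro h
    have := Int.le_of_dvd (by norm_num) h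
    have := hp.two_le
    omega
  have hcop : ∀ n : ℤ, (p : ℤ) ∣ 2 * n → (p : ℤ) ∣ n :=
    fun n h => (hpZ.dvd_or_dvd h).resolve_left hp2
  zify at hk hl
  have hprod : (p : ℤ) ^ 2 ∣ ((k : ℤ) - l) * (k + l + 1) := by
    have h : (p : ℤ) ^ 2 ∣ 2 ^ 2 * (((k : ℤ) - l) * (k + l + 1)) := by
      have := dvd_sub hk hl
      ring_nf at this ⊢
      exact this
    refine IsCoprime.dvd_of_dvd_mul_left ?_ h
    exact ((hpZ.irreducible.coprime_iff_not_dvd).mpr hp2).pow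
  by_cases h1 : (p : ℤ) ∣ (k : ℤ) - l
  · left
    have h2 : ¬ (p : ℤ) ∣ (k : ℤ) + l + 1 := by
      intro h2
      have h3 : (p : ℤ) ∣ 2 * k + 1 := by
        have h := dvd_add h1 h2
        rwa [show ((k : ℤ) - l) + (k + l + 1) = 2 * k + 1 by ring] at h
      have h5 : (p : ℤ) ∣ 4 := by
        have := dvd_sub ((dvd_pow_self (p : ℤ) two_ne_zero).trans hk)
          (h3.mul_left (2 * (k : ℤ) + 1))
        ring_nf at this
        exact this
      exact hp2 (hcop 2 (by simpa using h5))
    exact IsCoprime.dvd_of_dvd_mul_right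
      (((hpZ.irreducible.coprime_iff_not_dvd).mpr h2).pow_left) hprod
  · right
    exact IsCoprime.dvd_of_dvd_mul_left
      (((hpZ.irreducible.coprime_iff_not_dvd).mpr h1).pow_left) hprod

open Classical in
/-- The `k < K` for which the square of the prime `p` divides `(2k+1)² + 4`; empty if `p` is not
prime. -/
noncomputable def badIndices (K p : ℕ) : Finset ℕ :=
  (Finset.range K).filter fun k => p.Prime ∧ p ^ 2 ∣ (2 * k + 1) ^ 2 + 4

theorem card_badIndices_le (K p : ℕ) : (badIndices K p).card ≤ 2 * (K / p ^ 2 + 1) := by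
  classical
  rcases (badIndices K p).eq_empty_or_nonempty with h | ⟨l, hl⟩
  · simp [h]
  have hl' := (Finset.mem_filter.mp hl).2
  have hpos : 0 < p ^ 2 := pow_pos hl'.1.pos 2
  -- `r` is a natural number congruent to `-(l + 1)`
  set r : ℕ := (p ^ 2 - 1) * (l + 1) with hr
  have hsub : badIndices K p ⊆ (Finset.range K).filter (· ≡ l [MOD p ^ 2]) ∪
      (Finset.range K).filter (· ≡ r [MOD p ^ 2]) := by
    intro k hk
    obtain ⟨hkK, hk'⟩ := Finset.mem_filter.mp hk
    rw [Finset.mem_union, Finset.mem_filter, Finset.mem_filter]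
    refine (modEq_of_sq_dvd hl'.1 hk'.2 hl'.2).imp (fun h => ⟨hkK, ?_⟩) (fun h => ⟨hkK, ?_⟩)
    · exact ((Nat.modEq_iff_dvd.mpr (by exact_mod_cast h)) : l ≡ k [MOD p ^ 2]).symm
    · refine Nat.ModEq.symm (Nat.modEq_iff_dvd.mpr ?_)
      have : (k : ℤ) - r = (k + l + 1) - (p : ℤ) ^ 2 * (l + 1) := by
        rw [hr]
        push_cast [Nat.cast_sub hpos]
        ring
      rw [this]
      push_cast
      exact dvd_sub h (dvd_mul_right _ _)
  have hcount : ∀ v, ((Finset.range K).filter (· ≡ v [MOD p ^ 2])).card ≤ K / p ^ 2 + 1 := by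
    intro v
    rw [← Nat.count_eq_card_filter_range, Nat.count_modEq_card _ hpos]
    split_ifs <;> omega
  calc _ ≤ _ := Finset.card_le_card hsub
    _ ≤ _ := Finset.card_union_le _ _
    _ ≤ _ := by have := hcount l; have := hcount r; omega

theorem card_badIndices_le_one {K p : ℕ} (h : 2 * K < p ^ 2) : (badIndices K p).card ≤ 1 := by
  classical
  refine Finset.card_le_one.mpr fun k hk l hl => ?_
  obtain ⟨hkK, hk'⟩ := Finset.mem_filter.mp hk
  obtain ⟨hlK, hl'⟩ := Finset.mem_filter.mp hl
  rw [Finset.mem_range] at hkK hlK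
  zify at h
  rcases modEq_of_sq_dvd hk'.1 hk'.2 hl'.2 with hd | hd
  · have := Int.eq_zero_of_abs_lt_dvd hd (by rw [abs_lt]; constructor <;> omega)
    omega
  · have := Int.le_of_dvd (by omega) hd
    omega

/-- The summand is at most `1 / (4 (4m - 1)) - 1 / (4 (4m + 3))`, so the sum telescopes. -/
theorem sum_inv_sq_le (M : ℕ) :
    ∑ m ∈ Finset.Icc 1 M, 1 / (4 * m + 1 : ℚ) ^ 2 ≤ 1 / 12 - 1 / (4 * (4 * M + 3) : ℚ) := by
  induction M with
  | zero => norm_num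
  | succ M ih =>
    rw [Finset.sum_Icc_succ_top (by omega)]
    refine (add_le_add_left ih _).trans ?_
    have hM : (0 : ℚ) ≤ M := Nat.cast_nonneg M
    push_cast
    have : (1 : ℚ) / (4 * (M + 1) + 1) ^ 2
        ≤ 1 / (4 * (4 * M + 3)) - 1 / (4 * (4 * (M + 1) + 3)) := by
      rw [div_sub_div _ _ (by positivity) (by positivity),
        div_le_div_iff₀ (by positivity) (by positivity)]
      nlinarith
    linarith

/-- Each bad index belongs to a prime `p = 4m + 1`. The primes with `p² > 2K` contribute at most one
index each, hence at most `K / 2` in total; the others contribute `2(K / p² + 1)`, and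
`∑ 1 / p² ≤ 1 / 12`. -/
theorem card_filter_not_squarefree_le (L : ℕ) :
    (((Finset.range (2 * L ^ 2)).filter
      fun k => ¬ Squarefree ((2 * k + 1) ^ 2 + 4)).card : ℚ) ≤ 4 / 3 * L ^ 2 + 2 * L := by
  classical
  set K := 2 * L ^ 2 with hK
  have hsub : (Finset.range K).filter (fun k => ¬ Squarefree ((2 * k + 1) ^ 2 + 4)) ⊆
      (Finset.Icc 1 (L ^ 2)).biUnion fun m => badIndices K (4 * m + 1) := by
    intro k hk
    obtain ⟨hkK, hsq⟩ := Finset.mem_filter.mp hk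
    rw [Nat.squarefree_iff_prime_squarefree] at hsq
    push Not at hsq
    obtain ⟨p, hp, hd⟩ := hsq
    have h4 := prime_mod_four_of_dvd hp ((dvd_mul_right p p).trans hd)
    rw [Finset.mem_range] at hkK
    rw [Finset.mem_biUnion]
    have hp2 := hp.two_le
    obtain ⟨m, rfl⟩ : ∃ m, p = 4 * m + 1 := ⟨p / 4, by omega⟩
    refine ⟨m, Finset.mem_Icc.mpr ⟨by omega, ?_⟩,
      Finset.mem_filter.mpr ⟨Finset.mem_range.mpr hkK, hp, by rwa [sq]⟩⟩
    have hle := Nat.le_of_dvd (by positivity) hd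
    by_contra! hlt
    have : 2 * k + 3 ≤ 4 * m + 1 := by omega
    have := Nat.mul_le_mul this this
    nlinarith
  have hcard : ∀ m ∈ Finset.Icc 1 (L ^ 2), ((badIndices K (4 * m + 1)).card : ℚ) ≤
      1 + if m ∈ Finset.Icc 1 L then 2 * (K * (1 / (4 * m + 1 : ℚ) ^ 2) + 1) else 0 := by
    intro m hm
    split_ifs with h
    · have h1 : ((badIndices K (4 * m + 1)).card : ℚ) ≤
          2 * ((K / (4 * m + 1) ^ 2 : ℕ) + 1) := by
        exact_mod_cast card_badIndices_le K (4 * m + 1)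
      have h2 : ((K / (4 * m + 1) ^ 2 : ℕ) : ℚ) ≤ K * (1 / (4 * m + 1 : ℚ) ^ 2) := by
        refine Nat.cast_div_le.trans (le_of_eq ?_)
        push_cast
        ring
      linarith
    · have hLm : L < m := by
        by_contra! hc
        exact h (Finset.mem_Icc.mpr ⟨(Finset.mem_Icc.mp hm).1, hc⟩)
      have : (badIndices K (4 * m + 1)).card ≤ 1 := by
        apply card_badIndices_le_one
        nlinarith
      rw [add_zero]
      exact_mod_cast this
  have hfil : (Finset.Icc 1 (L ^ 2)).filter (· ∈ Finset.Icc 1 L) = Finset.Icc 1 L := by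
    ext m
    simp only [Finset.mem_filter, Finset.mem_Icc]
    refine ⟨fun h => h.2, fun h => ⟨⟨h.1, ?_⟩, h⟩⟩
    nlinarith [h.2]
  calc _ ≤ (((Finset.Icc 1 (L ^ 2)).biUnion fun m => badIndices K (4 * m + 1)).card : ℚ) := by
        exact_mod_cast Finset.card_le_card hsub
    _ ≤ ∑ m ∈ Finset.Icc 1 (L ^ 2), ((badIndices K (4 * m + 1)).card : ℚ) := by
        exact_mod_cast Finset.card_biUnion_le
    _ ≤ _ := Finset.sum_le_sum hcard
    _ = L ^ 2 + (2 * (K * ∑ m ∈ Finset.Icc 1 L, 1 / (4 * m + 1 : ℚ) ^ 2) + 2 * L) := by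
        rw [Finset.sum_add_distrib, ← Finset.sum_filter, hfil, ← Finset.mul_sum,
          Finset.sum_add_distrib, ← Finset.mul_sum]
        simp
        ring
    _ ≤ _ := by
        have h1 : ∑ m ∈ Finset.Icc 1 L, 1 / (4 * m + 1 : ℚ) ^ 2 ≤ 1 / 12 := by
          have := sum_inv_sq_le L
          have h0 : (0 : ℚ) ≤ 1 / (4 * (4 * L + 3)) := by positivity
          linarith
        have h2 := mul_le_mul_of_nonneg_left h1 (Nat.cast_nonneg (α := ℚ) K)
        have h3 : (K : ℚ) = 2 * L ^ 2 := by rw [hK]; push_cast; ring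
        rw [h3] at h2 ⊢
        linarith

/-- Among the first `2L²` odd numbers `2k + 1`, at most about two thirds have a value `(2k + 1)² + 4`
that is not square-free. -/
theorem infinite_squarefree_sq_add_four :
    {s : ℤ | 0 < s ∧ Squarefree (s ^ 2 + 4)}.Infinite := by
  classical
  have hex : ∀ n : ℕ, ∃ k, n ≤ k ∧ Squarefree ((2 * k + 1) ^ 2 + 4) := by
    intro n
    by_contra! hn
    set L := n + 4 with hL
    have h1 := card_filter_not_squarefree_le L
    have h2 : Finset.range (2 * L ^ 2) ⊆ Finset.range n ∪ ((Finset.range (2 * L ^ 2)).filter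
        fun k => ¬ Squarefree ((2 * k + 1) ^ 2 + 4)) := by
      intro k hk
      rw [Finset.mem_union, Finset.mem_filter, Finset.mem_range]
      rcases lt_or_ge k n with h | h
      · exact Or.inl h
      · exact Or.inr ⟨hk, hn k h⟩
    have h3 := (Finset.card_le_card h2).trans (Finset.card_union_le _ _)
    simp only [Finset.card_range] at h3
    have h4 : (2 * L ^ 2 : ℚ) ≤ n + ((Finset.range (2 * L ^ 2)).filter
        fun k => ¬ Squarefree ((2 * k + 1) ^ 2 + 4)).card := by exact_mod_cast h3
    have h5 : (L : ℚ) = n + 4 := by rw [hL]; push_cast; ring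
    have h6 : (0 : ℚ) ≤ n := Nat.cast_nonneg n
    rw [h5] at h1 h4
    nlinarith
  refine Set.infinite_of_not_bddAbove ?_
  rintro ⟨b, hb⟩
  obtain ⟨k, hk, hsq⟩ := hex b.toNat
  have := hb (show (2 * (k : ℤ) + 1) ∈ {s : ℤ | 0 < s ∧ Squarefree (s ^ 2 + 4)} from
    ⟨by omega, by rw [← Int.squarefree_natCast] at hsq; exact_mod_cast hsq⟩)
  omega

/-! ### The quadratic field `ℚ(√(s² + 4))` -/

/-- The situation of a field `F = ℚ(√D)` with `D = s² + 4` square-free and a choice `δ` of `√D`. -/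
structure IsSquarefreeGenerator {F : Type*} [Field F] [NumberField F] (s : ℤ) (δ : F) : Prop where
  squarefree : Squarefree (s ^ 2 + 4)
  sq : δ ^ 2 = (s : F) ^ 2 + 4
  adjoin : ℚ⟮δ⟯ = ⊤

theorem odd_of_squarefree_sq_add_four {s : ℤ} (h : Squarefree (s ^ 2 + 4)) : Odd s := by
  rw [← Int.not_even_iff_odd]
  rintro ⟨t, rfl⟩
  have := h 2 ⟨t ^ 2 + 1, by ring⟩
  rw [Int.isUnit_iff] at this
  omega

theorem not_isSquare_of_squarefree_sq_add_four {s : ℤ} (h : Squarefree (s ^ 2 + 4)) :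
    ¬ IsSquare ((s : ℚ) ^ 2 + 4) := by
  intro hsq
  have h1 : IsSquare (s ^ 2 + 4) := Rat.isSquare_intCast_iff.mp (by exact_mod_cast hsq)
  obtain ⟨r, hr⟩ := h1
  have hu := h r ⟨1, by rw [hr]; ring⟩
  rcases Int.isUnit_iff.mp hu with rfl | rfl <;> nlinarith [sq_nonneg s]

namespace IsSquarefreeGenerator

variable {F : Type*} [Field F] [NumberField F] {s : ℤ} {δ : F}

theorem rat_sq_ne (h : IsSquarefreeGenerator s δ) (r : ℚ) : r ^ 2 ≠ (s : ℚ) ^ 2 + 4 :=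
  fun hr => not_isSquare_of_squarefree_sq_add_four h.squarefree ⟨r, by rw [← hr]; ring⟩

theorem minpoly_eq (h : IsSquarefreeGenerator s δ) :
    minpoly ℚ δ = Polynomial.X ^ 2 - Polynomial.C ((s : ℚ) ^ 2 + 4) := by
  symm
  apply minpoly.eq_of_irreducible_of_monic
  · refine Polynomial.irreducible_of_degree_le_three_of_not_isRoot ?_ ?_
    · rw [Polynomial.natDegree_X_pow_sub_C]
      decide
    · intro r hr
      refine h.rat_sq_ne r ?_
      rw [Polynomial.IsRoot.def] at hr
      simp at hr
      linarith
  · simp [h.sq]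
  · exact Polynomial.monic_X_pow_sub_C _ two_ne_zero

theorem finrank_eq_two (h : IsSquarefreeGenerator s δ) : Module.finrank ℚ F = 2 := by
  rw [← IntermediateField.finrank_top', ← h.adjoin,
    IntermediateField.adjoin.finrank (Algebra.IsIntegral.isIntegral δ), h.minpoly_eq,
    Polynomial.natDegree_X_pow_sub_C]

theorem exists_eq_add_mul (h : IsSquarefreeGenerator s δ) (x : F) :
    ∃ a b : ℚ, x = a + b * δ := by
  have hli : LinearIndependent ℚ ![(1 : F), δ] := by
    rw [LinearIndependent.pair_iff]
    intro a b hab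
    by_cases hb : b = 0
    · subst hb
      simpa using hab
    · exfalso
      apply h.rat_sq_ne (a / b)
      have hb' : (b : F) ≠ 0 := by exact_mod_cast hb
      have h1 : δ = -(a / b : F) := by
        rw [Rat.smul_def, Rat.smul_def] at hab
        field_simp
        linear_combination hab
      have h2 := h.sq
      rw [h1, neg_sq] at h2
      exact_mod_cast h2
  have hspan := hli.span_eq_top_of_card_eq_finrank (by simp [h.finrank_eq_two])
  have hx : x ∈ Submodule.span ℚ (Set.range ![(1 : F), δ]) := hspan ▸ Submodule.mem_top
  rw [Matrix.range_cons, Matrix.range_cons, Matrix.range_empty, Set.union_empty,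
    Set.singleton_union, Submodule.mem_span_pair] at hx
  obtain ⟨a, b, rfl⟩ := hx
  exact ⟨a, b, by simp [Rat.smul_def]⟩

theorem ne_zero (h : IsSquarefreeGenerator s δ) : δ ≠ 0 := by
  rintro rfl
  have h1 := h.sq
  apply h.rat_sq_ne 0
  exact_mod_cast h1

theorem ringHom_ext (h : IsSquarefreeGenerator s δ) {R : Type*} [DivisionRing R]
    {σ τ : F →+* R} (hστ : σ δ = τ δ) : σ = τ := by
  ext x
  obtain ⟨a, b, rfl⟩ := h.exists_eq_add_mul x
  simp [hστ]

theorem ringHom_sq (h : IsSquarefreeGenerator s δ) {R : Type*} [CommRing R] (σ : F →+* R) :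
    σ δ ^ 2 = (s : R) ^ 2 + 4 := by
  rw [← map_pow, h.sq, map_add, map_pow, map_intCast, map_ofNat]

theorem exists_ringHom (h : IsSquarefreeGenerator s δ) {y : ℝ} (hy : y ^ 2 = (s : ℝ) ^ 2 + 4) :
    ∃ σ : F →+* ℝ, σ δ = y := by
  have hint : IsIntegral ℚ δ := Algebra.IsIntegral.isIntegral δ
  have hroot : y ∈ (minpoly ℚ δ).aroots ℝ := by
    rw [Polynomial.mem_aroots]
    refine ⟨minpoly.ne_zero hint, ?_⟩
    simp [h.minpoly_eq, hy]
  let f : ℚ⟮δ⟯ →ₐ[ℚ] ℝ :=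
    (IntermediateField.algHomAdjoinIntegralEquiv ℚ hint).symm ⟨y, hroot⟩
  have hmem : ∀ x : F, x ∈ ℚ⟮δ⟯ := fun x => h.adjoin ▸ IntermediateField.mem_top
  refine ⟨(f : ℚ⟮δ⟯ →+* ℝ).comp ((RingHom.id F).codRestrict ℚ⟮δ⟯.toSubfield hmem), ?_⟩
  exact IntermediateField.algHomAdjoinIntegralEquiv_symm_apply_gen ℚ hint ⟨y, hroot⟩

theorem isTotallyReal (h : IsSquarefreeGenerator s δ) : NumberField.IsTotallyReal F := by
  refine ⟨fun v => ?_⟩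
  rw [NumberField.InfinitePlace.isReal_iff, NumberField.ComplexEmbedding.isReal_iff]
  apply h.ringHom_ext
  set z := v.embedding δ with hz
  have h1 : z ^ 2 = (s : ℂ) ^ 2 + 4 := h.ringHom_sq _
  have h2 : (z - (√((s : ℝ) ^ 2 + 4) : ℝ)) * (z + (√((s : ℝ) ^ 2 + 4) : ℝ)) = 0 := by
    have h3 : (((√((s : ℝ) ^ 2 + 4) : ℝ) : ℂ)) ^ 2 = (s : ℂ) ^ 2 + 4 := by
      rw [← Complex.ofReal_pow, Real.sq_sqrt (by positivity)]
      push_cast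
      rfl
    linear_combination h1 - h3
  rw [NumberField.ComplexEmbedding.conjugate_coe_eq, ← hz]
  rcases mul_eq_zero.mp h2 with h3 | h3
  · rw [sub_eq_zero.mp h3, Complex.conj_ofReal]
  · rw [eq_neg_of_add_eq_zero_left h3, map_neg, Complex.conj_ofReal]

/-- There are exactly two real embeddings, and they send `δ` to `±√D`. -/
theorem exists_embeddings (h : IsSquarefreeGenerator s δ) :
    ∃ σ τ : F →+* ℝ, τ δ = -σ δ ∧ 0 < σ δ ∧ σ ≠ τ ∧ ∀ ρ, ρ = σ ∨ ρ = τ := by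
  have hD : (0 : ℝ) < (s : ℝ) ^ 2 + 4 := by positivity
  obtain ⟨σ, hσ⟩ := h.exists_ringHom (Real.sq_sqrt hD.le)
  obtain ⟨τ, hτ⟩ := h.exists_ringHom (y := -√((s : ℝ) ^ 2 + 4))
    (by rw [neg_sq, Real.sq_sqrt hD.le])
  have hpos : 0 < σ δ := by rw [hσ]; exact Real.sqrt_pos.mpr hD
  refine ⟨σ, τ, by rw [hτ, hσ], hpos, ?_, fun ρ => ?_⟩
  · rintro rfl
    linarith
  · have h1 : ρ δ ^ 2 = σ δ ^ 2 := by rw [h.ringHom_sq, h.ringHom_sq]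
    refine (sq_eq_sq_iff_eq_or_eq_neg.mp h1).imp h.ringHom_ext fun h2 => h.ringHom_ext ?_
    rw [h2, hτ, hσ]

/-- `(s + δ) / (2δ)` has norm `1 / D` and trace `1`. -/
theorem isTotallyPositive (h : IsSquarefreeGenerator s δ) :
    IsTotallyPositive (((s : F) + δ) / 2 / δ) := by
  intro σ
  have h1 : σ δ ^ 2 = (s : ℝ) ^ 2 + 4 := h.ringHom_sq σ
  have h0 : σ δ ≠ 0 := (map_ne_zero σ).mpr h.ne_zero
  have h2 : σ (((s : F) + δ) / 2 / δ) = ((s : ℝ) * σ δ + σ δ ^ 2) / (2 * σ δ ^ 2) := by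
    simp only [map_div₀, map_add, map_intCast, map_ofNat]
    field_simp
  rw [h2]
  refine div_pos ?_ (by positivity)
  have h3 : |(s : ℝ) * σ δ| < σ δ ^ 2 := by
    apply abs_lt_of_sq_lt_sq _ (sq_nonneg _)
    rw [mul_pow, h1]
    nlinarith [sq_nonneg (s : ℝ)]
  linarith [(abs_lt.mp h3).1]

/-- An integer of `F` has integral trace and norm, which by the square-freeness of `D ≡ 1 mod 4`
leaves only `ℤ ⊕ ℤ (δ - s) / 2`. -/
theorem exists_int_of_isIntegral (h : IsSquarefreeGenerator s δ) {x : F} (hx : IsIntegral ℤ x) :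
    ∃ m n : ℤ, x = m + n * ((δ - s) / 2) := by
  obtain ⟨σ, τ, hτ, -⟩ := h.exists_embeddings
  obtain ⟨a, b, rfl⟩ := h.exists_eq_add_mul x
  have h1 : σ δ ^ 2 = (s : ℝ) ^ 2 + 4 := h.ringHom_sq σ
  have hσx := hx.map σ.toIntAlgHom
  have hτx := hx.map τ.toIntAlgHom
  have hsum := hσx.add hτx
  have hmul := hσx.mul hτx
  simp only [RingHom.toIntAlgHom_coe, map_add, map_mul, map_ratCast, hτ] at hsum hmul
  rw [show (a : ℝ) + b * σ δ + (a + b * -σ δ) = algebraMap ℚ ℝ (2 * a) by simp; ring,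
    isIntegral_algebraMap_iff (algebraMap ℚ ℝ).injective] at hsum
  rw [show ((a : ℝ) + b * σ δ) * (a + b * -σ δ)
      = algebraMap ℚ ℝ (a ^ 2 - (s ^ 2 + 4) * b ^ 2) by simp; linear_combination -b ^ 2 * h1,
    isIntegral_algebraMap_iff (algebraMap ℚ ℝ).injective] at hmul
  obtain ⟨m, hm⟩ := IsIntegrallyClosed.isIntegral_iff.mp hsum
  obtain ⟨k, hk⟩ := IsIntegrallyClosed.isIntegral_iff.mp hmul
  simp only [eq_intCast] at hm hk
  -- `D (2b)²` is an integer, so the square of the denominator of `2b` divides `D`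
  obtain ⟨n, hn⟩ : ∃ n : ℤ, 2 * b = n := by
    have h2 : ((s : ℚ) ^ 2 + 4) * (2 * b) ^ 2 = (m ^ 2 - 4 * k : ℤ) := by
      push_cast
      rw [hm, hk]
      ring
    set r := 2 * b with hr
    have hden : (r.den : ℚ) ≠ 0 := by exact_mod_cast r.den_nz
    have h3 : (s ^ 2 + 4) * r.num ^ 2 = (m ^ 2 - 4 * k) * (r.den : ℤ) ^ 2 := by
      rw [← Rat.num_div_den r, div_pow, mul_div_assoc', div_eq_iff (pow_ne_zero 2 hden)] at h2
      exact_mod_cast h2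
    have hcop : IsCoprime ((r.den : ℤ) ^ 2) (r.num ^ 2) := by
      refine IsCoprime.pow ?_
      rw [Int.isCoprime_iff_gcd_eq_one, Int.gcd_comm]
      simpa [Int.gcd] using r.reduced
    have h4 : (r.den : ℤ) * r.den ∣ s ^ 2 + 4 := by
      rw [← _root_.sq]
      exact hcop.dvd_of_dvd_mul_right ⟨m ^ 2 - 4 * k, by rw [h3]; ring⟩
    have h5 := h.squarefree _ h4
    rw [Int.ofNat_isUnit, Nat.isUnit_iff] at h5
    exact ⟨r.num, ((Rat.den_eq_one_iff r).mp h5).symm⟩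
  obtain ⟨t, rfl⟩ := odd_of_squarefree_sq_add_four h.squarefree
  have h6 : m ^ 2 - ((2 * t + 1) ^ 2 + 4) * n ^ 2 = 4 * k := by
    have : (m : ℚ) ^ 2 - ((2 * t + 1) ^ 2 + 4) * n ^ 2 = 4 * k := by
      rw [hm, hk, ← hn]
      push_cast
      ring
    exact_mod_cast this
  have hpar : Even (m + n) := by
    have h7 : Even ((m + n) * (m + n)) :=
      ⟨2 * k + (2 * t ^ 2 + 2 * t + 3) * n ^ 2 + m * n, by linear_combination h6⟩
    simpa [Int.even_mul] using h7
  obtain ⟨q, hq⟩ := hpar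
  refine ⟨q + t * n, n, ?_⟩
  have ha : (a : F) = m / 2 := by
    rw [eq_div_iff two_ne_zero]
    have : a * 2 = (m : ℚ) := by linear_combination -hm
    exact_mod_cast this
  have hb : (b : F) = n / 2 := by
    rw [eq_div_iff two_ne_zero]
    have : b * 2 = (n : ℚ) := by linear_combination hn
    exact_mod_cast this
  have hq' : (m : F) + n = q + q := by exact_mod_cast hq
  rw [ha, hb]
  push_cast
  linear_combination hq' / 2

end IsSquarefreeGenerator

/-! ### The maximal order -/

section Trace

variable {F : Type*} [Field F]

theorem Quaternion.isIntegral_star {q : ℍ[F]} (hq : IsIntegral (𝓞 F) q) :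
    IsIntegral (𝓞 F) (star q) := by
  obtain ⟨p, hp, h⟩ := hq
  refine ⟨p, hp, ?_⟩
  rw [← Polynomial.aeval_def, Polynomial.aeval_eq_sum_range] at h ⊢
  have h1 := congrArg star h
  rw [star_zero, star_sum] at h1
  rw [← h1]
  refine Finset.sum_congr rfl fun n _ => ?_
  change (p.coeff n : F) • star q ^ n = star ((p.coeff n : F) • q ^ n)
  rw [Quaternion.star_smul, star_pow]

open scoped IsMulCommutative in
/-- The reduced trace of an integral quaternion is integral: `q` and its conjugate are integral
elements of the commutative algebra `F[q]`. -/
theorem Quaternion.isIntegral_two_mul_re {q : ℍ[F]} (hq : IsIntegral (𝓞 F) q) :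
    IsIntegral (𝓞 F) (2 * q.re) := by
  let S := Algebra.adjoin F {q}
  let x : S := ⟨q, Algebra.subset_adjoin rfl⟩
  let y : S := algebraMap F S (2 * q.re) - x
  have hval : Function.Injective (S.val.restrictScalars (𝓞 F)) := Subtype.val_injective
  have hy : S.val y = star q := by
    have h := Quaternion.self_add_star q
    change algebraMap F ℍ[F] (2 * q.re) - q = star q
    rw [sub_eq_iff_eq_add', h, map_mul, map_ofNat, Quaternion.algebraMap_def]
  have hx' : IsIntegral (𝓞 F) x := (isIntegral_algHom_iff _ hval).mp hq
  have hy' : IsIntegral (𝓞 F) y := by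
    refine (isIntegral_algHom_iff _ hval).mp ?_
    change IsIntegral (𝓞 F) (S.val y)
    rw [hy]
    exact Quaternion.isIntegral_star hq
  have hxy : x + y = algebraMap F S (2 * q.re) := by simp [y]
  have h := hx'.add hy'
  rw [hxy] at h
  exact (isIntegral_algebraMap_iff (algebraMap F S).injective).mp h

/-- The reduced trace of an element of an order is an integer of `F`. -/
theorem IsQuaternionOrder.exists_trace_eq {O : Subalgebra (𝓞 F) ℍ[F]} (hO : IsQuaternionOrder O)
    {q : ℍ[F]} (hq : q ∈ O) : ∃ a : 𝓞 F, 2 * q.re = a := by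
  have h := Quaternion.isIntegral_two_mul_re (IsIntegral.of_mem_of_fg O hO.1 q hq)
  exact ⟨⟨2 * q.re, isIntegral_trans _ h⟩, rfl⟩

end Trace

theorem Submodule.mem_span_quadruple {R M : Type*} [Ring R] [AddCommGroup M] [Module R M]
    {e₁ e₂ e₃ e₄ x : M} : x ∈ Submodule.span R {e₁, e₂, e₃, e₄} ↔
      ∃ a b c d : R, x = a • e₁ + b • e₂ + c • e₃ + d • e₄ := by
  simp only [Submodule.mem_span_insert, Submodule.mem_span_singleton]
  constructor
  · rintro ⟨a, _, ⟨b, _, ⟨c, _, ⟨d, rfl⟩, rfl⟩, rfl⟩, rfl⟩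
    exact ⟨a, b, c, d, by abel⟩
  · rintro ⟨a, b, c, d, rfl⟩
    exact ⟨a, _, ⟨b, _, ⟨c, _, ⟨d, rfl⟩, rfl⟩, rfl⟩, by abel⟩

/-- Membership in the module `explicitOrderModule δ`, with `w = (1 + δ) / 2`. -/
theorem mem_explicitOrderModule_iff {F : Type*} [Field F] [CharZero F] {δ : F} {w : 𝓞 F}
    (hw : (w : F) = (1 + δ) / 2) {q : ℍ[F]} :
    q ∈ explicitOrderModule δ ↔ ∃ a b c d : 𝓞 F,
      q.re = a + (c * w + d * (w + 1)) / 2 ∧ q.imI = b + (c * (w + 1) + d * w) / 2 ∧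
      q.imJ = c / 2 ∧ q.imK = d / 2 := by
  have hδ : δ = 2 * w - 1 := by rw [hw]; ring
  subst hδ
  refine Submodule.mem_span_quadruple.trans (exists₄_congr fun a b c d => ?_)
  refine Quaternion.ext_iff.trans (and_congr ?_ (and_congr ?_ (and_congr ?_ ?_)))
  · change _ = (a : F) * 1 + b * 0 + c * ((2 * w - 1 + 1) / 4) + d * ((2 * w - 1 + 3) / 4) ↔ _
    ring_nf
  · change _ = (a : F) * 0 + b * 1 + c * ((2 * w - 1 + 3) / 4) + d * ((2 * w - 1 + 1) / 4) ↔ _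
    ring_nf
  · change _ = (a : F) * 0 + b * 0 + c * (1 / 2) + d * 0 ↔ _
    ring_nf
  · change _ = (a : F) * 0 + b * 0 + c * 0 + d * (1 / 2) ↔ _
    ring_nf

theorem mul_mem_explicitOrderModule {F : Type*} [Field F] [CharZero F] {δ : F} {w u : 𝓞 F}
    (hw : (w : F) = (1 + δ) / 2) (hu : w ^ 2 = w + 2 * u + 1) {q r : ℍ[F]}
    (hq : q ∈ explicitOrderModule δ) (hr : r ∈ explicitOrderModule δ) :
    q * r ∈ explicitOrderModule δ := by
  rw [mem_explicitOrderModule_iff hw] at *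
  obtain ⟨a, b, c, d, h1, h2, h3, h4⟩ := hq
  obtain ⟨a', b', c', d', h1', h2', h3', h4'⟩ := hr
  have hu' : (w : F) ^ 2 = w + 2 * u + 1 := by
    have h := congrArg (algebraMap (𝓞 F) F) hu
    rwa [map_pow, map_add, map_add, map_mul, map_ofNat, map_one] at h
  refine ⟨a * a' - b * b' - b * c' * (w + 1) - b' * d * w - (c * c' + d * d') * (w + u + 1)
      - c' * d * (w * (w + 1)),
    a * b' + b * a' + b * d' * (w + 1) + b' * c * w + (c * d' - d * c') * (w + u + 1),
    a * c' - b * d' + c * a' + d * b' + c * c' * w + c' * d * (w + 1),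
    a * d' + b * c' - c * b' + d * a' + d * d' * (w + 1) + d * c' * w, ?_, ?_, ?_, ?_⟩
  · rw [Quaternion.re_mul, h1, h2, h3, h4, h1', h2', h3', h4']
    simp only [map_add, map_sub, map_mul, map_one, NumberField.RingOfIntegers.val]  at *
    linear_combination (-(c * c' + d * d' : F) / 2) * hu'
  · rw [Quaternion.imI_mul, h1, h2, h3, h4, h1', h2', h3', h4']
    simp only [map_add, map_sub, map_mul, map_one, NumberField.RingOfIntegers.val]  at *
    linear_combination ((c * d' - d * c' : F) / 2) * hu'
  · rw [Quaternion.imJ_mul, h1, h2, h3, h4, h1', h2', h3', h4']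
    simp only [map_add, map_sub, map_mul, map_one, NumberField.RingOfIntegers.val]
    ring
  · rw [Quaternion.imK_mul, h1, h2, h3, h4, h1', h2', h3', h4']
    simp only [map_add, map_sub, map_mul, map_one, NumberField.RingOfIntegers.val]
    ring

theorem span_explicitOrderModule {F : Type*} [Field F] [CharZero F] (δ : F) :
    Submodule.span F (explicitOrderModule δ : Set ℍ[F]) = ⊤ := by
  refine eq_top_iff.mpr (le_trans ?_ (Submodule.span_mono Submodule.subset_span))
  intro q _
  refine Submodule.mem_span_quadruple.mpr
    ⟨q.re - q.imJ * ((δ + 1) / 2) - q.imK * ((δ + 3) / 2),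
      q.imI - q.imJ * ((δ + 3) / 2) - q.imK * ((δ + 1) / 2), 2 * q.imJ, 2 * q.imK, ?_⟩
  apply Quaternion.ext
  · change q.re = (_ : F) * 1 + _ * 0 + _ * ((δ + 1) / 4) + _ * ((δ + 3) / 4)
    ring
  · change q.imI = (_ : F) * 0 + _ * 1 + _ * ((δ + 3) / 4) + _ * ((δ + 1) / 4)
    ring
  · change q.imJ = (_ : F) * 0 + _ * 0 + _ * (1 / 2) + _ * 0
    ring
  · change q.imK = (_ : F) * 0 + _ * 0 + _ * 0 + _ * (1 / 2)
    ring

/-- The module `explicitOrderModule δ` contains its dual with respect to the reduced trace, which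
contains every order above it. -/
theorem isMaximalQuaternionOrder_of_toSubmodule_eq {F : Type*} [Field F] [CharZero F] {δ : F}
    {w : 𝓞 F} (hw : (w : F) = (1 + δ) / 2) {O : Subalgebra (𝓞 F) ℍ[F]}
    (hO : Subalgebra.toSubmodule O = explicitOrderModule δ) : IsMaximalQuaternionOrder O := by
  have hmem : ∀ q : ℍ[F], q ∈ O ↔ q ∈ explicitOrderModule δ := fun q => by
    rw [← hO]
    rfl
  refine ⟨⟨?_, ?_⟩, fun O' hO' hle => le_antisymm (fun q hq => ?_) hle⟩
  · rw [hO]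
    exact Submodule.fg_span ((((Set.finite_singleton _).insert _).insert _).insert _)
  · rw [← span_explicitOrderModule δ, ← hO]
    rfl
  · have hmul : ∀ e ∈ explicitOrderModule δ, ∃ a : 𝓞 F,
        2 * (q.re * e.re - q.imI * e.imI - q.imJ * e.imJ - q.imK * e.imK) = a := fun e he => by
      rw [← Quaternion.re_mul]
      exact hO'.exists_trace_eq (O'.mul_mem hq (hle ((hmem e).mpr he)))
    obtain ⟨X, hX⟩ := hO'.exists_trace_eq hq
    obtain ⟨Y, hY⟩ := hmul ⟨0, 1, 0, 0⟩
      ((mem_explicitOrderModule_iff hw).mpr ⟨0, 1, 0, 0, by simp, by simp, by simp, by simp⟩)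
    obtain ⟨A, hA⟩ := hmul ⟨w / 2, (w + 1) / 2, 1 / 2, 0⟩
      ((mem_explicitOrderModule_iff hw).mpr ⟨0, 0, 1, 0, by simp, by simp, by simp, by simp⟩)
    obtain ⟨B, hB⟩ := hmul ⟨(w + 1) / 2, w / 2, 0, 1 / 2⟩
      ((mem_explicitOrderModule_iff hw).mpr ⟨0, 0, 0, 1, by simp, by simp, by simp, by simp⟩)
    rw [hmem, mem_explicitOrderModule_iff hw]
    refine ⟨-X * (w ^ 2 + w) - Y * (w * (w + 1)) + A * w + B * (w + 1),
      -Y * (w ^ 2 + w + 1) - X * (w * (w + 1)) + A * (w + 1) + B * w,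
      X * w + Y * (w + 1) - 2 * A, X * (w + 1) + Y * w - 2 * B, ?_, ?_, ?_, ?_⟩ <;>
    · simp only [map_add, map_sub, map_mul, map_one, map_pow, map_neg, map_ofNat,
        NumberField.RingOfIntegers.val] at *
      simp only [← hX, ← hY, ← hA, ← hB]
      ring

/-- With `s = 2t + 1`, the element `w = (1 + δ) / 2` satisfies `w² = w + (t² + t) + 1`, where
`t² + t` is even. -/
theorem exists_integer_eq_half {F : Type*} [Field F] [CharZero F] {s : ℤ} (hs : Odd s) {δ : F}
    (hδ : δ ^ 2 = (s : F) ^ 2 + 4) :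
    ∃ w u : 𝓞 F, (w : F) = (1 + δ) / 2 ∧ w ^ 2 = w + 2 * u + 1 := by
  obtain ⟨t, rfl⟩ := hs
  obtain ⟨u, hu⟩ := Int.even_mul_succ_self t
  have hu' : (t : F) * (t + 1) = u + u := by exact_mod_cast hu
  have heq : ((1 + δ) / 2) ^ 2 = (1 + δ) / 2 + 2 * u + 1 := by
    push_cast at hδ
    linear_combination hδ / 4 + hu'
  have hint : IsIntegral ℤ ((1 + δ) / 2) := by
    refine ⟨Polynomial.X ^ 2 + (- Polynomial.X - Polynomial.C (2 * u + 1 : ℤ)), ?_, ?_⟩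
    · apply Polynomial.monic_X_pow_add
      rw [neg_sub_left, Polynomial.degree_neg, add_comm]
      refine lt_of_eq_of_lt (Polynomial.degree_X_add_C _) (by norm_num)
    · simp only [Polynomial.eval₂_add, Polynomial.eval₂_sub, Polynomial.eval₂_neg,
        Polynomial.eval₂_pow, Polynomial.eval₂_X, Polynomial.eval₂_C]
      rw [eq_intCast]
      push_cast
      linear_combination heq
  refine ⟨⟨_, hint⟩, u, rfl, ?_⟩
  apply NumberField.RingOfIntegers.ext
  exact heq

/-- The module `explicitOrderModule δ` as a subring. -/
theorem exists_subalgebra_toSubmodule_eq {F : Type*} [Field F] [CharZero F] {δ : F} {w u : 𝓞 F}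
    (hw : (w : F) = (1 + δ) / 2) (hu : w ^ 2 = w + 2 * u + 1) :
    ∃ O : Subalgebra (𝓞 F) ℍ[F], Subalgebra.toSubmodule O = explicitOrderModule δ :=
  ⟨(explicitOrderModule δ).toSubalgebra
    ((mem_explicitOrderModule_iff hw).mpr ⟨1, 0, 0, 0, by simp, by simp, by simp, by simp⟩)
    fun _ _ => mul_mem_explicitOrderModule hw hu, Submodule.toSubalgebra_toSubmodule _ _ _⟩

/-! ### The isometry with `E₈` -/

/-- The vector in `ℝ⁸` of sums and differences of four pairs among the eight coordinates
`a 0, …, a 3, b 0, …, b 3`. The union of any two of these pairs is a codeword of the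
extended Hamming code in `mem_latticeE8_iff`, so the entries are all integers or all half-integers
if `a, b` are the halves of a vector of `ℤ⁸` that reduces modulo two to a codeword. -/
noncomputable def pairSums (a b : Fin 4 → ℝ) : EuclideanSpace ℝ (Fin 8) :=
  !₂[a 0 + b 0, a 0 - b 0, a 1 + b 2, a 1 - b 2, b 1 + a 3, b 1 - a 3, b 3 + a 2, b 3 - a 2]

theorem norm_sq_pairSums (a b : Fin 4 → ℝ) :
    ‖pairSums a b‖ ^ 2 = ∑ l, 2 * (a l ^ 2 + b l ^ 2) := by
  rw [EuclideanSpace.real_norm_sq_eq]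
  simp [pairSums, Fin.sum_univ_eight, Fin.sum_univ_four]
  ring

theorem pairSums_add (a b a' b' : Fin 4 → ℝ) :
    pairSums (a + a') (b + b') = pairSums a b + pairSums a' b' := by
  ext i
  fin_cases i <;> simp [pairSums] <;> ring

theorem pairSums_smul (c : ℝ) (a b : Fin 4 → ℝ) :
    pairSums (c • a) (c • b) = c • pairSums a b := by
  ext i
  fin_cases i <;> simp [pairSums] <;> ring

/-- The coordinates `a 0, …, a 3` of half the vector of `ℤ⁸` with parameters `A₁, …, d₂` that reduces
modulo two to a codeword of the extended Hamming code. -/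
def hammingFst (K : Type*) [DivisionRing K] (A₁ B₁ c₁ c₂ d₁ d₂ : ℤ) : Fin 4 → K :=
  ![A₁ + (c₂ + d₁ + d₂) / 2, B₁ + (c₁ + c₂ + d₂) / 2, c₁ / 2, d₁ / 2]

/-- The coordinates `b 0, …, b 3` that go with `hammingFst`. -/
def hammingSnd (K : Type*) [DivisionRing K] (A₂ B₂ c₁ c₂ d₁ d₂ : ℤ) : Fin 4 → K :=
  ![A₂ + (c₁ - c₂ + d₁) / 2, B₂ + (c₁ + d₁ - d₂) / 2, c₂ / 2, d₂ / 2]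

/-- The `E₈` lattice as the image under `pairSums` of half the vectors of `ℤ⁸` that reduce modulo
two to a codeword of an extended Hamming code. -/
theorem mem_latticeE8_iff (v : EuclideanSpace ℝ (Fin 8)) :
    v ∈ latticeE8 ↔ ∃ A₁ A₂ B₁ B₂ c₁ c₂ d₁ d₂ : ℤ,
      v = pairSums (hammingFst ℝ A₁ B₁ c₁ c₂ d₁ d₂)
        (hammingSnd ℝ A₂ B₂ c₁ c₂ d₁ d₂) := by
  constructor
  · rintro ⟨h | h, M, hM⟩
    · choose m hm using h
      rw [Fin.sum_univ_eight] at hM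
      refine ⟨M - (m 2 + m 4 + m 6 + m 7), M - (m 1 + m 3 + m 4 + m 6), m 3 - m 6, m 5 + m 7,
        m 6 - m 7, m 2 - m 3, m 4 - m 5, m 6 + m 7, ?_⟩
      ext i
      fin_cases i <;> simp [pairSums, hammingFst, hammingSnd] <;> simp only [hm] at hM ⊢ <;> linarith
    · choose m hm using h
      rw [Fin.sum_univ_eight] at hM
      refine ⟨M - (m 2 + m 4 + m 6 + m 7) - 2, M - (m 1 + m 3 + m 4 + m 6) - 2, m 3 - m 6,
        m 5 + m 7 + 1, m 6 - m 7, m 2 - m 3, m 4 - m 5, m 6 + m 7 + 1, ?_⟩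
      ext i
      fin_cases i <;> simp [pairSums, hammingFst, hammingSnd] <;> simp only [hm] at hM ⊢ <;> linarith
  · rintro ⟨A₁, A₂, B₁, B₂, c₁, c₂, d₁, d₂, rfl⟩
    refine ⟨?_, A₁ + B₁ + B₂ + c₁ + c₂ + d₁ + d₂, ?_⟩
    · rcases Int.even_or_odd' (c₁ + d₂) with ⟨k, hk | hk⟩
      · obtain rfl : d₂ = 2 * k - c₁ := by linarith
        left
        intro i
        fin_cases i
        · exact ⟨A₁ + A₂ + d₁ + k, by simp [pairSums, hammingFst, hammingSnd]; ring⟩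
        · exact ⟨A₁ - A₂ + c₂ - c₁ + k, by simp [pairSums, hammingFst, hammingSnd]; ring⟩
        · exact ⟨B₁ + c₂ + k, by simp [pairSums, hammingFst, hammingSnd]; ring⟩
        · exact ⟨B₁ + k, by simp [pairSums, hammingFst, hammingSnd]; ring⟩
        · exact ⟨B₂ + d₁ + c₁ - k, by simp [pairSums, hammingFst, hammingSnd]; ring⟩
        · exact ⟨B₂ + c₁ - k, by simp [pairSums, hammingFst, hammingSnd]; ring⟩
        · exact ⟨k, by simp [pairSums, hammingFst, hammingSnd]; ring⟩
        · exact ⟨k - c₁, by simp [pairSums, hammingFst, hammingSnd]; ring⟩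
      · obtain rfl : d₂ = 2 * k + 1 - c₁ := by linarith
        right
        intro i
        fin_cases i
        · exact ⟨A₁ + A₂ + d₁ + k, by simp [pairSums, hammingFst, hammingSnd]; ring⟩
        · exact ⟨A₁ - A₂ + c₂ - c₁ + k, by simp [pairSums, hammingFst, hammingSnd]; ring⟩
        · exact ⟨B₁ + c₂ + k, by simp [pairSums, hammingFst, hammingSnd]; ring⟩
        · exact ⟨B₁ + k, by simp [pairSums, hammingFst, hammingSnd]; ring⟩
        · exact ⟨B₂ + d₁ + c₁ - k - 1, by simp [pairSums, hammingFst, hammingSnd]; ring⟩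
        · exact ⟨B₂ + c₁ - k - 1, by simp [pairSums, hammingFst, hammingSnd]; ring⟩
        · exact ⟨k, by simp [pairSums, hammingFst, hammingSnd]; ring⟩
        · exact ⟨k - c₁, by simp [pairSums, hammingFst, hammingSnd]; ring⟩
    · simp [pairSums, hammingFst, hammingSnd, Fin.sum_univ_eight]
      ring

section Isometry

variable {ι : Type*} [Fintype ι] {σ τ : ι} {p p' f f' : ℝ}

/-- If `(p, p')` and `(p f, p' f')` form an orthonormal basis of `ℝ²`, applying it to each of the
pairs `v (e l, σ), v (e l, τ)` and then `pairSums`, scaled by `1 / √2`, is an isometry. -/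
theorem exists_isometry_pairSums (hne : σ ≠ τ) (hall : ∀ ρ, ρ = σ ∨ ρ = τ)
    (hp : p ^ 2 * (1 + f ^ 2) = 1) (hp' : p' ^ 2 * (1 + f' ^ 2) = 1) (hf : f * f' = -1)
    (e : Equiv.Perm (Fin 4)) :
    ∃ φ : EuclideanSpace ℝ (Fin 4 × ι) ≃ₗᵢ[ℝ] EuclideanSpace ℝ (Fin 8), ∀ v,
      φ v = pairSums (fun l => (p * v (e l, σ) + p' * v (e l, τ)) / √2)
        (fun l => (p * f * v (e l, σ) + p' * f' * v (e l, τ)) / √2) := by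
  classical
  have huniv : (Finset.univ : Finset ι) = {σ, τ} := by
    ext ρ
    simpa using hall ρ
  let L : EuclideanSpace ℝ (Fin 4 × ι) →ₗ[ℝ] EuclideanSpace ℝ (Fin 8) :=
    { toFun := fun v => pairSums (fun l => (p * v (e l, σ) + p' * v (e l, τ)) / √2)
        (fun l => (p * f * v (e l, σ) + p' * f' * v (e l, τ)) / √2)
      map_add' := fun v w => by
        rw [← pairSums_add]
        congr 1 <;> (ext l; simp; ring)
      map_smul' := fun c v => by
        rw [← pairSums_smul]
        congr 1 <;> (ext l; simp; ring) }
  have hLv : ∀ v, L v = pairSums (fun l => (p * v (e l, σ) + p' * v (e l, τ)) / √2)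
      (fun l => (p * f * v (e l, σ) + p' * f' * v (e l, τ)) / √2) := fun _ => rfl
  have hL : ∀ v, ‖L v‖ = ‖v‖ := by
    intro v
    rw [← sq_eq_sq₀ (norm_nonneg _) (norm_nonneg _), EuclideanSpace.real_norm_sq_eq v,
      Fintype.sum_prod_type, ← Equiv.sum_comp e fun l => ∑ ρ, v (l, ρ) ^ 2]
    rw [hLv, norm_sq_pairSums]
    refine Finset.sum_congr rfl fun l _ => ?_
    rw [huniv, Finset.sum_pair hne, div_pow, div_pow, Real.sq_sqrt zero_le_two]
    linear_combination (v (e l, σ)) ^ 2 * hp + (v (e l, τ)) ^ 2 * hp'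
      + 2 * p * p' * v (e l, σ) * v (e l, τ) * hf
  refine ⟨(⟨L, hL⟩ : _ →ₗᵢ[ℝ] _).toLinearIsometryEquiv ?_, hLv⟩
  rw [finrank_euclideanSpace, finrank_euclideanSpace, Fintype.card_prod, Fintype.card_fin,
    Fintype.card_fin, ← Finset.card_univ (α := ι), huniv, Finset.card_pair hne]

end Isometry

namespace IsSquarefreeGenerator

variable {F : Type*} [Field F] [NumberField F] {s : ℤ} {δ : F}

/-- The ring of integers of `F` is `ℤ ⊕ ℤ η` for `η = (δ - s) / 2`. -/
theorem exists_int_eq (h : IsSquarefreeGenerator s δ) (a : 𝓞 F) :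
    ∃ m n : ℤ, (a : F) = m + n * ((δ - s) / 2) :=
  h.exists_int_of_isIntegral a.isIntegral_coe

/-- The elements of `ℤ ⊕ ℤ η` are integers of `F`. -/
theorem exists_integer_eq (h : IsSquarefreeGenerator s δ) (m n : ℤ) :
    ∃ a : 𝓞 F, (a : F) = m + n * ((δ - s) / 2) := by
  obtain ⟨w, u, hw, -⟩ := exists_integer_eq_half (odd_of_squarefree_sq_add_four h.squarefree) h.sq
  obtain ⟨t, rfl⟩ := odd_of_squarefree_sq_add_four h.squarefree
  refine ⟨m + n * (w - t - 1), ?_⟩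
  simp only [NumberField.RingOfIntegers.val, map_add, map_sub, map_mul, map_one, map_intCast] at *
  rw [hw]
  push_cast
  ring

/-- The element `(1 + δ) / 2` is congruent to `η = (δ - s) / 2` or to `η + 1` modulo two. Hence,
possibly after exchanging the first two coordinates, it may be replaced by `η` in the description
of the module `explicitOrderModule δ`. -/
theorem exists_perm_mem_iff (h : IsSquarefreeGenerator s δ) :
    ∃ e : Equiv.Perm (Fin 4), ∀ q : ℍ[F], q ∈ explicitOrderModule δ ↔ ∃ a b c d : 𝓞 F,
      quaternionCoord q (e 0) = a + (c * ((δ - s) / 2) + d * ((δ - s) / 2 + 1)) / 2 ∧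
      quaternionCoord q (e 1) = b + (c * ((δ - s) / 2 + 1) + d * ((δ - s) / 2)) / 2 ∧
      quaternionCoord q (e 2) = c / 2 ∧ quaternionCoord q (e 3) = d / 2 := by
  obtain ⟨w, u, hw, -⟩ := exists_integer_eq_half (odd_of_squarefree_sq_add_four h.squarefree) h.sq
  obtain ⟨t, rfl⟩ := odd_of_squarefree_sq_add_four h.squarefree
  have hδ : δ = 2 * w - 1 := by rw [hw]; ring
  rcases Int.even_or_odd' t with ⟨r, rfl | rfl⟩
  · refine ⟨Equiv.swap 0 1, fun q => (mem_explicitOrderModule_iff hw).trans ?_⟩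
    rw [Equiv.swap_apply_left, Equiv.swap_apply_right,
      Equiv.swap_apply_of_ne_of_ne (by decide) (by decide),
      Equiv.swap_apply_of_ne_of_ne (by decide) (by decide)]
    constructor
    · rintro ⟨a, b, c, d, h1, h2, h3, h4⟩
      refine ⟨b + c * (r + 1) + d * r, a + c * r + d * (r + 1), c, d, h2.trans ?_, h1.trans ?_,
        h3, h4⟩ <;>
      · simp only [NumberField.RingOfIntegers.val, map_add, map_mul, map_one, map_intCast] at *
        rw [hδ]
        push_cast
        ring
    · rintro ⟨a, b, c, d, h1, h2, h3, h4⟩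
      refine ⟨b - (c * r + d * (r + 1)), a - (c * (r + 1) + d * r), c, d, h2.trans ?_,
        h1.trans ?_, h3, h4⟩ <;>
      · simp only [NumberField.RingOfIntegers.val, map_add, map_sub, map_mul, map_one,
          map_intCast] at *
        rw [hδ]
        push_cast
        ring
  · refine ⟨1, fun q => (mem_explicitOrderModule_iff hw).trans ?_⟩
    constructor
    · rintro ⟨a, b, c, d, h1, h2, h3, h4⟩
      refine ⟨a + (c + d) * (r + 1), b + (c + d) * (r + 1), c, d, h1.trans ?_, h2.trans ?_,
        h3, h4⟩ <;>
      · simp only [NumberField.RingOfIntegers.val, map_add, map_mul, map_one, map_intCast] at *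
        rw [hδ]
        push_cast
        ring
    · rintro ⟨a, b, c, d, h1, h2, h3, h4⟩
      refine ⟨a - (c + d) * (r + 1), b - (c + d) * (r + 1), c, d, h1.trans ?_, h2.trans ?_,
        h3, h4⟩ <;>
      · simp only [NumberField.RingOfIntegers.val, map_add, map_sub, map_mul, map_one,
          map_intCast] at *
        rw [hδ]
        push_cast
        ring

/-- The previous description in integer coordinates with respect to the basis `1, η` of the ring of
integers, where `η = (δ - s) / 2`. -/
theorem exists_perm_mem_iff_int (h : IsSquarefreeGenerator s δ) :
    ∃ e : Equiv.Perm (Fin 4), ∀ q : ℍ[F], q ∈ explicitOrderModule δ ↔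
      ∃ A₁ A₂ B₁ B₂ c₁ c₂ d₁ d₂ : ℤ, ∀ l, quaternionCoord q (e l) =
        hammingFst F A₁ B₁ c₁ c₂ d₁ d₂ l +
        hammingSnd F A₂ B₂ c₁ c₂ d₁ d₂ l *
          ((δ - s) / 2) := by
  obtain ⟨e, he⟩ := h.exists_perm_mem_iff
  refine ⟨e, fun q => (he q).trans ?_⟩
  obtain ⟨t, rfl⟩ := odd_of_squarefree_sq_add_four h.squarefree
  simp only [Fin.forall_fin_succ, IsEmpty.forall_iff, and_true]
  set η := (δ - ((2 * t + 1 : ℤ) : F)) / 2 with hη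
  have hη2 : η ^ 2 = 1 - (2 * t + 1) * η := by
    have := h.sq
    rw [hη]
    push_cast at this ⊢
    linear_combination this / 4
  constructor
  · rintro ⟨a, b, c, d, h1, h2, h3, h4⟩
    obtain ⟨A₁, A₂, hA⟩ := h.exists_int_eq a
    obtain ⟨B₁, B₂, hB⟩ := h.exists_int_eq b
    obtain ⟨c₁, c₂, hc⟩ := h.exists_int_eq c
    obtain ⟨d₁, d₂, hd⟩ := h.exists_int_eq d
    rw [← hη] at hA hB hc hd
    refine ⟨A₁, A₂ - t * (c₂ + d₂), B₁, B₂ - t * (c₂ + d₂), c₁, c₂, d₁, d₂,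
      h1.trans ?_, h2.trans ?_, h3.trans ?_, h4.trans ?_⟩ <;> simp [hammingFst, hammingSnd, hA, hB, hc, hd]
    · linear_combination (c₂ + d₂ : F) / 2 * hη2
    · linear_combination (c₂ + d₂ : F) / 2 * hη2
    · ring
    · ring
  · rintro ⟨A₁, A₂, B₁, B₂, c₁, c₂, d₁, d₂, h1, h2, h3, h4⟩
    obtain ⟨a, hA⟩ := h.exists_integer_eq A₁ (A₂ + t * (c₂ + d₂))
    obtain ⟨b, hB⟩ := h.exists_integer_eq B₁ (B₂ + t * (c₂ + d₂))
    obtain ⟨c, hc⟩ := h.exists_integer_eq c₁ c₂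
    obtain ⟨d, hd⟩ := h.exists_integer_eq d₁ d₂
    rw [← hη] at hA hB hc hd
    refine ⟨a, b, c, d, h1.trans ?_, h2.trans ?_, h3.trans ?_, h4.trans ?_⟩ <;>
      simp [hammingFst, hammingSnd, hA, hB, hc, hd]
    · linear_combination -(c₂ + d₂ : F) / 2 * hη2
    · linear_combination -(c₂ + d₂ : F) / 2 * hη2
    · ring
    · ring

/-- The form `x, y ↦ Tr (α x y)` has the orthonormal basis `1, η`, so the coordinates with respect to
this basis turn the twisted embedding into `√2` times the standard embedding into `ℝ⁸`. -/
theorem latticeSimilar (h : IsSquarefreeGenerator s δ) {O : Subalgebra (𝓞 F) ℍ[F]}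
    (hO : Subalgebra.toSubmodule O = explicitOrderModule δ) :
    LatticeSimilar (twistedLattice O (((s : F) + δ) / 2 / δ)) latticeE8 := by
  obtain ⟨σ, τ, hτ, hpos, hne, hall⟩ := h.exists_embeddings
  obtain ⟨e, he⟩ := h.exists_perm_mem_iff_int
  set α := ((s : F) + δ) / 2 / δ with hα
  set η := (δ - s) / 2 with hη
  have hδ := h.ne_zero
  have hα0 : ∀ ρ : F →+* ℝ, 0 < ρ α := h.isTotallyPositive
  have hnorm : α * (1 + η ^ 2) = 1 := by
    rw [hα, hη]
    field_simp
    linear_combination (δ - (s : F)) * h.sq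
  have hp : ∀ ρ : F →+* ℝ, √(ρ α) ^ 2 * (1 + (ρ η) ^ 2) = 1 := fun ρ => by
    rw [Real.sq_sqrt (hα0 ρ).le, ← map_pow, ← map_one ρ, ← map_add, ← map_mul, hnorm]
  have hση : σ η = (σ δ - s) / 2 := by
    rw [hη]
    simp only [map_div₀, map_sub, map_intCast, map_ofNat]
  have hτη : τ η = (-σ δ - s) / 2 := by
    rw [hη, ← hτ]
    simp only [map_div₀, map_sub, map_intCast, map_ofNat]
  have hf : σ η * τ η = -1 := by
    rw [hση, hτη]
    linear_combination -h.ringHom_sq σ / 4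
  have hσα : σ α = (s + σ δ) / 2 / σ δ := by
    rw [hα]
    simp only [map_div₀, map_add, map_intCast, map_ofNat]
  have hτα : τ α = (s - σ δ) / 2 / (-σ δ) := by
    rw [hα]
    simp only [map_div₀, map_add, map_intCast, map_ofNat, hτ, sub_eq_add_neg]
  have htr : σ α + τ α = 1 := by
    rw [hσα, hτα]
    field_simp
    ring
  have htr1 : σ α * σ η + τ α * τ η = 0 := by
    rw [hσα, hτα, hση, hτη]
    field_simp
    ring
  have htr2 : σ α * σ η ^ 2 + τ α * τ η ^ 2 = 1 := by
    have h1 := hp σ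
    have h2 := hp τ
    rw [Real.sq_sqrt (hα0 _).le] at h1 h2
    linear_combination h1 + h2 - htr
  obtain ⟨φ, hφ⟩ := exists_isometry_pairSums hne hall (hp σ) (hp τ) hf e
  -- by the trace relations, `φ` recovers the coordinates of `q` in the basis `1, η`
  have key : ∀ (q : ℍ[F]) (a b : Fin 4 → ℚ),
      (∀ l, quaternionCoord q (e l) = a l + b l * η) →
      φ (twistedEmbedding α q) = pairSums (fun l => (a l : ℝ)) (fun l => (b l : ℝ)) := by
    intro q a b hq
    have hv : ∀ (ρ : F →+* ℝ) l, twistedEmbedding α q (e l, ρ) =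
        √2 * √(ρ α) * (a l + b l * ρ η) := by
      intro ρ l
      change √(2 * ρ α) * ρ (quaternionCoord q (e l)) = _
      rw [hq, Real.sqrt_mul zero_le_two]
      simp
    have h2 : √(2 : ℝ) ≠ 0 := by positivity
    have hσ2 := Real.mul_self_sqrt (hα0 σ).le
    have hτ2 := Real.mul_self_sqrt (hα0 τ).le
    rw [hφ]
    congr 1 <;> ext l <;> rw [hv, hv, div_eq_iff h2]
    · linear_combination √2 * ((a l + b l * σ η) * hσ2 + (a l + b l * τ η) * hτ2
        + a l * htr + b l * htr1)
    · linear_combination √2 * (σ η * (a l + b l * σ η) * hσ2 + τ η * (a l + b l * τ η) * hτ2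
        + a l * htr1 + b l * htr2)
  have key' : ∀ (q : ℍ[F]) (A₁ A₂ B₁ B₂ c₁ c₂ d₁ d₂ : ℤ), (∀ l, quaternionCoord q (e l) =
        hammingFst F A₁ B₁ c₁ c₂ d₁ d₂ l +
        hammingSnd F A₂ B₂ c₁ c₂ d₁ d₂ l * η) →
      φ (twistedEmbedding α q) =
        pairSums (hammingFst ℝ A₁ B₁ c₁ c₂ d₁ d₂)
        (hammingSnd ℝ A₂ B₂ c₁ c₂ d₁ d₂) := by
    intro q A₁ A₂ B₁ B₂ c₁ c₂ d₁ d₂ hq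
    rw [key q (hammingFst ℚ A₁ B₁ c₁ c₂ d₁ d₂)
        (hammingSnd ℚ A₂ B₂ c₁ c₂ d₁ d₂)]
    · congr 1 <;> ext l <;> fin_cases l <;> simp [hammingFst, hammingSnd]
    · intro l
      rw [hq l]
      fin_cases l <;> simp [hammingFst, hammingSnd]
  refine ⟨1, φ, one_pos, ?_⟩
  ext v
  simp only [one_smul, SetLike.mem_coe, mem_latticeE8_iff]
  constructor
  · rintro ⟨_, ⟨q, hq, rfl⟩, rfl⟩
    obtain ⟨A₁, A₂, B₁, B₂, c₁, c₂, d₁, d₂, hq'⟩ := (he q).mp (hO ▸ hq)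
    exact ⟨A₁, A₂, B₁, B₂, c₁, c₂, d₁, d₂, key' q _ _ _ _ _ _ _ _ hq'⟩
  · rintro ⟨A₁, A₂, B₁, B₂, c₁, c₂, d₁, d₂, rfl⟩
    set u : Fin 4 → F := fun l =>
      hammingFst F A₁ B₁ c₁ c₂ d₁ d₂ l +
        hammingSnd F A₂ B₂ c₁ c₂ d₁ d₂ l * η
      with hu
    let q : ℍ[F] := ⟨u (e.symm 0), u (e.symm 1), u (e.symm 2), u (e.symm 3)⟩
    have hcoord : ∀ k, quaternionCoord q k = u (e.symm k) := by
      intro k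
      fin_cases k <;> rfl
    have hq : ∀ l, quaternionCoord q (e l) = u l := fun l => by
      rw [hcoord, Equiv.symm_apply_apply]
    refine ⟨twistedEmbedding α q, ⟨q, ?_, rfl⟩, key' q _ _ _ _ _ _ _ _ hq⟩
    have : q ∈ explicitOrderModule δ := (he q).mpr ⟨A₁, A₂, B₁, B₂, c₁, c₂, d₁, d₂, hq⟩
    rw [← hO] at this
    exact this

end IsSquarefreeGenerator

/-! ### The fields inside `ℝ` -/

/-- A quadratic field contains the square root of only one square-free number `s² + 4`. -/
theorem IsSquarefreeGenerator.sq_add_four_eq {F : Type*} [Field F] [NumberField F] {s s' : ℤ}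
    {δ δ' : F} (h : IsSquarefreeGenerator s δ) (hs' : Squarefree (s' ^ 2 + 4))
    (hδ' : δ' ^ 2 = (s' : F) ^ 2 + 4) : s ^ 2 + 4 = s' ^ 2 + 4 := by
  obtain ⟨a, b, rfl⟩ := h.exists_eq_add_mul δ'
  have hδ := h.sq
  have hab : a * b = 0 := by
    by_contra hab
    have habF : (2 * (a * b) : F) ≠ 0 := mul_ne_zero two_ne_zero (by exact_mod_cast hab)
    apply h.rat_sq_ne ((s' ^ 2 + 4 - a ^ 2 - b ^ 2 * (s ^ 2 + 4)) / (2 * (a * b)))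
    have h1 : δ = ((s' : F) ^ 2 + 4 - a ^ 2 - b ^ 2 * (s ^ 2 + 4)) / (2 * (a * b)) := by
      rw [eq_div_iff habF]
      linear_combination hδ' - (b : F) ^ 2 * hδ
    rw [h1] at hδ
    exact_mod_cast hδ
  have hb : b ≠ 0 := by
    rintro rfl
    apply not_isSquare_of_squarefree_sq_add_four hs'
    refine ⟨a, ?_⟩
    rw [Rat.cast_zero, zero_mul, add_zero] at hδ'
    rw [← _root_.sq]
    exact_mod_cast hδ'.symm
  obtain rfl := (mul_eq_zero.mp hab).resolve_right hb
  have h1 : b ^ 2 * ((s : ℚ) ^ 2 + 4) = (s' : ℚ) ^ 2 + 4 := by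
    rw [Rat.cast_zero, zero_add, mul_pow, hδ] at hδ'
    exact_mod_cast hδ'
  have hden : (b.den : ℚ) ≠ 0 := by exact_mod_cast b.den_nz
  have h2 : b.num ^ 2 * (s ^ 2 + 4) = (s' ^ 2 + 4) * (b.den : ℤ) ^ 2 := by
    rw [← Rat.num_div_den b, div_pow, div_mul_eq_mul_div, div_eq_iff (pow_ne_zero 2 hden)] at h1
    exact_mod_cast h1
  have hcop : IsCoprime (b.num ^ 2) ((b.den : ℤ) ^ 2) := by
    refine IsCoprime.pow ?_
    rw [Int.isCoprime_iff_gcd_eq_one]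
    simpa [Int.gcd] using b.reduced
  have hd : (b.den : ℤ) * b.den ∣ s ^ 2 + 4 := by
    rw [← _root_.sq]
    exact hcop.symm.dvd_of_dvd_mul_left ⟨s' ^ 2 + 4, by rw [h2]; ring⟩
  have hn : b.num * b.num ∣ s' ^ 2 + 4 := by
    rw [← _root_.sq]
    exact hcop.dvd_of_dvd_mul_right ⟨s ^ 2 + 4, by rw [← h2]⟩
  have hd1 := Int.isUnit_sq (h.squarefree _ hd)
  have hn1 := Int.isUnit_sq (hs' _ hn)
  rwa [hd1, hn1, one_mul, mul_one] at h2

instance numberField_adjoin_sqrt (s : ℤ) : NumberField ℚ⟮√((s : ℝ) ^ 2 + 4)⟯ where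
  to_finiteDimensional := by
    have : FiniteDimensional ℚ ℚ⟮√((s : ℝ) ^ 2 + 4)⟯ := by
      apply IntermediateField.adjoin.finiteDimensional
      refine IsIntegral.of_pow two_pos ?_
      rw [Real.sq_sqrt (by positivity)]
      have h := isIntegral_algebraMap (R := ℚ) (A := ℝ) (x := (s ^ 2 + 4 : ℤ))
      rw [eq_ratCast] at h
      exact_mod_cast h
    convert this

theorem IntermediateField.adjoin_gen_eq_top (K : Type*) {E : Type*} [Field K] [Field E]
    [Algebra K E] (x : E) : K⟮IntermediateField.AdjoinSimple.gen K x⟯ = ⊤ := by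
  apply IntermediateField.lift_injective
  rw [IntermediateField.lift_adjoin_simple, IntermediateField.lift_top,
    IntermediateField.AdjoinSimple.coe_gen]

theorem isSquarefreeGenerator_gen {s : ℤ} (hs : Squarefree (s ^ 2 + 4)) :
    IsSquarefreeGenerator s (IntermediateField.AdjoinSimple.gen ℚ √((s : ℝ) ^ 2 + 4)) where
  squarefree := hs
  sq := by
    apply Subtype.ext
    push_cast
    rw [IntermediateField.AdjoinSimple.coe_gen, Real.sq_sqrt (by positivity)]
    rfl
  adjoin := by
    -- the two `ℚ`-algebra structures on the subfield agree
    convert IntermediateField.adjoin_gen_eq_top ℚ √((s : ℝ) ^ 2 + 4) <;>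
      exact Subsingleton.elim _ _

theorem adjoin_sqrt_injOn :
    Set.InjOn (fun s : ℤ => ℚ⟮√((s : ℝ) ^ 2 + 4)⟯) {s | 0 < s ∧ Squarefree (s ^ 2 + 4)} := by
  rintro s ⟨hs0, hs⟩ s' ⟨hs0', hs'⟩ heq
  have hmem : √((s' : ℝ) ^ 2 + 4) ∈ ℚ⟮√((s : ℝ) ^ 2 + 4)⟯ := by
    simp only at heq
    rw [heq]
    exact IntermediateField.mem_adjoin_simple_self ℚ _
  have h := (isSquarefreeGenerator_gen hs).sq_add_four_eq (δ' := ⟨_, hmem⟩) hs' (by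
    apply Subtype.ext
    push_cast
    rw [Real.sq_sqrt (by positivity)]
    rfl)
  nlinarith

theorem exists_maximalOrder_latticeSimilar {F : Type*} [Field F] [NumberField F] {s : ℤ} {δ : F}
    (h : IsSquarefreeGenerator s δ) :
    ∃ O : Subalgebra (𝓞 F) ℍ[F], Subalgebra.toSubmodule O = explicitOrderModule δ ∧
      IsMaximalQuaternionOrder O ∧
      LatticeSimilar (twistedLattice O (((s : F) + δ) / 2 / δ)) latticeE8 := by
  obtain ⟨w, u, hw, hu⟩ := exists_integer_eq_half (odd_of_squarefree_sq_add_four h.squarefree) h.sq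
  obtain ⟨O, hO⟩ := exists_subalgebra_toSubmodule_eq hw hu
  exact ⟨O, hO, isMaximalQuaternionOrder_of_toSubmodule_eq hw hO, h.latticeSimilar hO⟩

theorem adjoin_sqrt_mem_quadraticFieldsE8 {s : ℤ} (hs : Squarefree (s ^ 2 + 4)) :
    ℚ⟮√((s : ℝ) ^ 2 + 4)⟯ ∈ quadraticFieldsE8 := by
  have h := isSquarefreeGenerator_gen hs
  obtain ⟨O, -, hmax, hsim⟩ := exists_maximalOrder_latticeSimilar h
  exact ⟨numberField_adjoin_sqrt s, by convert h.finrank_eq_two, h.isTotallyReal, O, _, hmax,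
    h.isTotallyPositive, hsim⟩

theorem infinite_adjoin_sqrt :
    {F : IntermediateField ℚ ℝ | ∃ s : ℤ, Squarefree (s ^ 2 + 4) ∧
      F = ℚ⟮√((s : ℝ) ^ 2 + 4)⟯}.Infinite :=
  Set.infinite_of_injOn_mapsTo adjoin_sqrt_injOn (fun s hs => ⟨s, hs.2, rfl⟩)
    infinite_squarefree_sq_add_four

theorem corollaryE88 :
    quadraticFieldsE8.Infinite ∧
    {F : IntermediateField ℚ ℝ | ∃ s : ℤ, Squarefree (s ^ 2 + 4) ∧
      F = ℚ⟮√((s : ℝ) ^ 2 + 4)⟯}.Infinite ∧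
    (∀ s : ℤ, Squarefree (s ^ 2 + 4) → ℚ⟮√((s : ℝ) ^ 2 + 4)⟯ ∈ quadraticFieldsE8) ∧
    ∀ (s : ℤ), Squarefree (s ^ 2 + 4) →
      ∀ (F : Type*) [Field F] [NumberField F] (δ : F), δ ^ 2 = (s : F) ^ 2 + 4 → ℚ⟮δ⟯ = ⊤ →
        Module.finrank ℚ F = 2 ∧ NumberField.IsTotallyReal F ∧
        IsTotallyPositive (((s : F) + δ) / 2 / δ) ∧
        ∃ O : Subalgebra (𝓞 F) ℍ[F],
          Subalgebra.toSubmodule O = explicitOrderModule δ ∧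
          IsMaximalQuaternionOrder O ∧
          LatticeSimilar (twistedLattice O (((s : F) + δ) / 2 / δ)) latticeE8 := by
  refine ⟨infinite_adjoin_sqrt.mono ?_, infinite_adjoin_sqrt,
    fun s hs => adjoin_sqrt_mem_quadraticFieldsE8 hs, fun s hs F _ _ δ hδ htop => ?_⟩
  · rintro _ ⟨s, hs, rfl⟩
    exact adjoin_sqrt_mem_quadraticFieldsE8 hs
  · have h : IsSquarefreeGenerator s δ := ⟨hs, hδ, htop⟩
    exact ⟨h.finrank_eq_two, h.isTotallyReal, h.isTotallyPositive,
      exists_maximalOrder_latticeSimilar h⟩
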